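/- **Setting.** Let $(\mathbf C,\mathcal M)$ be an $\mathcal M$-adhesive category: $\mathcal M$ is a class of monomorphisms containing all isomorphisms and closed under composition and decomposition ($g\circ f\in\mathcal M$, $g\in\mathcal M$ imply $f\in\mathcal M$); pushouts and pullbacks along $\mathcal M$-morphisms exist, and $\mathcal M$ is closed under them; and pushouts along $\mathcal M$-morphisms are $\mathcal M$-van Kampen (for each commutative cube over such a pushout whose vertical morphisms are in $\mathcal M$ and whose back faces are pullbacks, the top face is a pushout iff the front faces are pullbacks). Assume that $\mathbf C$ has binary coproducts and that, for a class $\mathcal E'$ of pairs of morphisms with common codomain, each pair $(f_1,f_2)$ with common codomain factors as $f_i=m\circ e_i$ with $(e_1,e_2)\in\mathcal E'$, $m\in\mathcal M$, uniquely up to isomorphism. *Application conditions (ACs)* over $P$ are built from $\exists(a,c)$ ($a\colon P\to C$, $c$ an AC over $C$), negations, and conjunctions over finite or, more generally, arbitrary small index sets. A morphism $p\colon P\to G$ satisfies $\exists(a,c)$, written $p\models\exists(a,c)$, if there is $q\in\mathcal M$ with $q\circ a=p$ and $q\models c$; $\neg$ and $\bigwedge$ are interpreted as usual. For $b\colon P\to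 P'$, $\mathrm{Shift}(b,\exists(a,c))=\bigvee\exists(a',\mathrm{Shift}(b',c))$ over all $(a',b')\in\mathcal E'$ with $b'\in\mathcal M$, $b'\circ a=a'\circ b$. For a span $\rho=(L\leftarrow I\to R)$, $\mathrm{Left}(\rho,\exists(a,c))=\exists(b,\mathrm{Left}(\rho^*,c))$ if $(I\to R,\ a\colon R\to X)$ has a pushout complement $I\to Z\to X$, where $b\colon L\to Y$ and $\rho^*=(Y\leftarrow Z\to X)$ result from the pushout of $L\leftarrow I\to Z$; otherwise it is $\mathrm{false}$. Both commute with $\neg$ and $\bigwedge$. A *rule* $\rho=(p,ac_L)$ is a plain rule $p=(L\leftarrow I\to R)$ with both morphisms in $\mathcal M$ and an AC $ac_L$ over $L$. A *plain transformation* of $G$ by $p$ with match $o\colon L\to G$ is a pair of pushouts giving $G\xleftarrow{k}D\xrightarrow{c}H$; it is a *transformation* by $\rho$ if $o\models ac_L$. A (plain) *transformation pair* $H_1\Leftarrow G\Rightarrow H_2$ consists of (plain) transformations of the same $G$ by a first and a second rule (indices $1,2$). A plain pair is *parallel independent* if there are $d_{12}\colon L_1\to D_2$, $d_{21}\colon L_2\to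 D_1$ with $k_2d_{12}=o_1$, $k_1d_{21}=o_2$; for rules with ACs one also requires $c_2d_{12}\models ac_{L_1}$ and $c_1d_{21}\models ac_{L_2}$. Otherwise it is *parallel dependent* (*in conflict*). A pair is a *use-delete* (*delete-use*) conflict if $d_{12}$ ($d_{21}$) does not exist, and an *AC conflict* if $d_{12}$ exists but $c_2d_{12}\not\models ac_{L_1}$, or $d_{21}$ exists but $c_1d_{21}\not\models ac_{L_2}$. An *embedding* of a plain pair on $K$ into one on $G$, via the same plain rules, is an extension morphism $m\colon K\to G$ together with extension diagrams: morphisms between the objects $D_i$ and between the results of the transformations, compatible with matches, comatches and $I_i\to D_i$, such that the squares between the derived spans are pushouts. A plain pair $tp^I$ is *initial for* $tp$ if it embeds into $tp$ via some $f^I$ and, for each plain pair $tp'$ embedded into $tp$ via some $f$, there is exactly one embedding of $tp^I$ into $tp'$ whose extension morphism $g$ satisfies $f\circ g=f^I$. A *plain initial conflict* is a plain pair in conflict that is isomorphic to a pair initial for it. Let $tp_{L_1+L_2}\colon R_1+L_2\Leftarrow L_1+L_2\Rightarrow L_1+R_2$ be the plain pair whose matches are the coproduct injections. A *symbolic transformation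 pair* for $(\rho_1,\rho_2)$ is $stp_K=\langle tp_K,ac_K,ac^*_K\rangle$ with $tp_K$ a plain pair on $K$ with matches $o_i$, $ac_K=\mathrm{Shift}(o_1,ac_{L_1})\wedge\mathrm{Shift}(o_2,ac_{L_2})$, and $ac^*_K=\neg(ac^*_{K,d_{12}}\wedge ac^*_{K,d_{21}})$, where $ac^*_{K,d_{12}}=\mathrm{Left}\big(K\xleftarrow{k_2}D_2\xrightarrow{c_2}P_2,\ \mathrm{Shift}(c_2d_{12},ac_{L_1})\big)$ if some $d_{12}$ with $k_2d_{12}=o_1$ exists and $\mathrm{false}$ otherwise, and symmetrically for $ac^*_{K,d_{21}}$. It is *conflict-inducing* if $tp_K$ embeds into some parallel dependent transformation pair for $(\rho_1,\rho_2)$. An *initial conflict* for $(\rho_1,\rho_2)$ is a conflict-inducing $stp_K$ such that either $tp_K$ is a plain initial conflict (*use-delete/delete-use initial conflict*) or $tp_K$ is parallel independent as a plain pair and isomorphic to $tp_{L_1+L_2}$ (*AC initial conflict*). **Theorem (completeness of initial conflicts).** Let $\mathcal R$ be a set of rules such that for all rules in $\mathcal R$ every plain transformation pair in conflict, via the underlying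 plain rules, has an initial plain transformation pair, and let $\rho_1,\rho_2\in\mathcal R$. Then the set of initial conflicts for $(\rho_1,\rho_2)$ is complete with respect to parallel dependence: for each parallel dependent transformation pair $H_1\Leftarrow G\Rightarrow H_2$ for $(\rho_1,\rho_2)$ there are an initial conflict $stp_K$ and an embedding of $tp_K$ into the pair via an extension morphism $m\colon K\to G$ with $m\models ac_K\wedge ac^*_K$. Moreover: 1. if the pair is a use-delete or delete-use conflict, $stp_K$ can be chosen to be a use-delete/delete-use initial conflict; 2. if the pair is an AC conflict and neither a use-delete nor a delete-use conflict, one can take $tp_K=tp_{L_1+L_2}$, and $stp_{L_1+L_2}$ is then an AC initial conflict. -/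

import Mathlib

open CategoryTheory CategoryTheory.Limits

universe v u

namespace MAdhesive

section Categories

variable {C : Type u} [Category.{v} C]

/-- `(C, M)` is an `M`-adhesive category. -/
structure IsMAdhesive (M : MorphismProperty C) : Prop where
  mono : ∀ ⦃A B : C⦄ (f : A ⟶ B), M f → Mono f
  iso : ∀ ⦃A B : C⦄ (f : A ⟶ B), IsIso f → M f
  comp : ∀ ⦃A B D : C⦄ (f : A ⟶ B) (g : B ⟶ D), M f → M g → M (f ≫ g)
  decomp : ∀ ⦃A B D : C⦄ (f : A ⟶ B) (g : B ⟶ D), M (f ≫ g) → M g → M f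
  hasPushout : ∀ ⦃A B D : C⦄ (f : A ⟶ B) (g : A ⟶ D), M f → HasPushout f g
  hasPullback : ∀ ⦃A B D : C⦄ (f : A ⟶ D) (g : B ⟶ D), M f → HasPullback f g
  pushout_closed : ∀ ⦃W X Y Z : C⦄ (f : W ⟶ X) (g : W ⟶ Y) (h : X ⟶ Z) (i : Y ⟶ Z),
    IsPushout f g h i → M f → M i
  pullback_closed : ∀ ⦃W X Y Z : C⦄ (f : W ⟶ X) (g : W ⟶ Y) (h : X ⟶ Z) (i : Y ⟶ Z),
    IsPullback f g h i → M h → M g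
  /-- Pushouts along `M`-morphisms are `M`-van Kampen squares: for every commutative cube
  over such a pushout whose vertical morphisms are in `M` and whose back faces are pullbacks,
  the top face is a pushout iff the front faces are pullbacks. -/
  vanKampen : ∀ ⦃W X Y Z : C⦄ (f : W ⟶ X) (g : W ⟶ Y) (h : X ⟶ Z) (i : Y ⟶ Z),
    IsPushout f g h i → M f →
    ∀ ⦃W' X' Y' Z' : C⦄ (f' : W' ⟶ X') (g' : W' ⟶ Y') (h' : X' ⟶ Z') (i' : Y' ⟶ Z')
      (αW : W' ⟶ W) (αX : X' ⟶ X) (αY : Y' ⟶ Y) (αZ : Z' ⟶ Z),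
      M αW → M αX → M αY → M αZ →
      IsPullback f' αW αX f → IsPullback g' αW αY g →
      CommSq h' αX αZ h → CommSq i' αY αZ i → CommSq f' g' h' i' →
      (IsPushout f' g' h' i' ↔ IsPullback h' αX αZ h ∧ IsPullback i' αY αZ i)

/-- A class `E'` of pairs of morphisms with the same codomain. -/
abbrev PairClass (C : Type u) [Category.{v} C] : Type (max u v) :=
  ∀ ⦃A B K : C⦄, (A ⟶ K) → (B ⟶ K) → Prop

/-- `(e₁, e₂, m)` is an `E'`-`M` pair factorization of `(f₁, f₂)`. -/
def IsPairFactorization (E : PairClass C) (M : MorphismProperty C) {A₁ A₂ B K : C}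
    (f₁ : A₁ ⟶ B) (f₂ : A₂ ⟶ B) (e₁ : A₁ ⟶ K) (e₂ : A₂ ⟶ K) (m : K ⟶ B) : Prop :=
  E e₁ e₂ ∧ M m ∧ e₁ ≫ m = f₁ ∧ e₂ ≫ m = f₂

/-- Every pair of morphisms with the same codomain has an `E'`-`M` pair factorization, and it is
unique up to isomorphism. -/
def HasUniquePairFactorization (E : PairClass C) (M : MorphismProperty C) : Prop :=
  ∀ ⦃A₁ A₂ B : C⦄ (f₁ : A₁ ⟶ B) (f₂ : A₂ ⟶ B),
    (∃ (K : C) (e₁ : A₁ ⟶ K) (e₂ : A₂ ⟶ K) (m : K ⟶ B),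
      IsPairFactorization E M f₁ f₂ e₁ e₂ m) ∧
    ∀ ⦃K K' : C⦄ (e₁ : A₁ ⟶ K) (e₂ : A₂ ⟶ K) (m : K ⟶ B)
      (e₁' : A₁ ⟶ K') (e₂' : A₂ ⟶ K') (m' : K' ⟶ B),
      IsPairFactorization E M f₁ f₂ e₁ e₂ m → IsPairFactorization E M f₁ f₂ e₁' e₂' m' →
      ∃ φ : K ≅ K', e₁ ≫ φ.hom = e₁' ∧ e₂ ≫ φ.hom = e₂' ∧ φ.hom ≫ m' = m

/-! ### Nested application conditions -/

/-- Nested application conditions over an object. Conjunctions over arbitrary (small) index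
types are allowed, finite ones being a special case: in a general `M`-adhesive category the shift
of a finitely branching condition need not be finitely branching. -/
inductive AC {C : Type u} [Category.{v} C] : C → Type (max u v + 1)
  | ex {P Q : C} (a : P ⟶ Q) (c : AC Q) : AC P
  | neg {P : C} (c : AC P) : AC P
  | conj {P : C} {I : Type (max u v)} (c : I → AC P) : AC P

namespace AC

/-- The condition `true`: the empty conjunction. -/
def tt (P : C) : AC P := conj (I := PEmpty) PEmpty.elim

/-- The condition `false`. -/
def ff (P : C) : AC P := neg (tt P)

/-- Binary conjunction. -/
def and {P : C} (c c' : AC P) : AC P :=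
  conj (I := ULift Bool) fun b => if b.down then c else c'

/-- Disjunction. -/
def disj {P : C} {I : Type (max u v)} (c : I → AC P) : AC P :=
  neg (conj fun i => neg (c i))

/-- `c.Sat M p`: the morphism `p` satisfies the application condition `c`. -/
def Sat (M : MorphismProperty C) : {P : C} → AC P → {G : C} → (P ⟶ G) → Prop
  | _, ex (Q := Q) a c, G, p => ∃ q : Q ⟶ G, M q ∧ a ≫ q = p ∧ Sat M c q
  | _, neg c, _, p => ¬ Sat M c p
  | _, conj c, _, p => ∀ i, Sat M (c i) p

/-- Commutative squares `b' ∘ a = a' ∘ b` with `(a', b') ∈ E'` and `b' ∈ M`. -/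
structure ShiftIndex (E : PairClass C) (M : MorphismProperty C) {P P' Q : C}
    (b : P ⟶ P') (a : P ⟶ Q) : Type (max u v) where
  Q' : C
  a' : P' ⟶ Q'
  b' : Q ⟶ Q'
  mem_E : E a' b'
  mem_M : M b'
  w : a ≫ b' = b ≫ a'

/-- `c.shift E M b` is `Shift(b, c)`, with
`Shift(b, ∃(a, c)) = ⋁_{(a', b')} ∃(a', Shift(b', c))` over all squares in `ShiftIndex`. -/
def shift (E : PairClass C) (M : MorphismProperty C) :
    {P : C} → AC P → {P' : C} → (P ⟶ P') → AC P'
  | _, ex a c, _, b => disj fun x : ShiftIndex E M b a => ex x.a' (shift E M c x.b')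
  | _, neg c, _, b => neg (shift E M c b)
  | _, conj c, _, b => conj fun i => shift E M (c i) b

/-- A double pushout
```
  L <--l-- I --r--> R
  |b       |i       |a
  Y <--y-- Z --x--> X
```
over the given span `(l, r)` and the given morphism `a`: a pushout complement of `(r, a)` followed
by a pushout of `l`. -/
structure DPOCompletion {L I R X : C} (l : I ⟶ L) (r : I ⟶ R) (a : R ⟶ X) :
    Type (max u v) where
  Y : C
  Z : C
  b : L ⟶ Y
  i : I ⟶ Z
  y : Z ⟶ Y
  x : Z ⟶ X
  right : IsPushout r i a x
  left : IsPushout l i b y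

open Classical in
/-- `c.left l r` is `Left(L ← I → R, c)` for a condition `c` over `R`:
`Left(ρ, ∃(a, c)) = ∃(b, Left(ρ*, c))` with `ρ*` the span `Y ← Z → X` derived from `ρ` along `a`
if `(r, a)` has a pushout complement, and `false` otherwise. -/
noncomputable def left : {R : C} → AC R → {L I : C} → (I ⟶ L) → (I ⟶ R) → AC L
  | _, ex a c, L, _, l, r =>
    if h : Nonempty (DPOCompletion l r a) then ex h.some.b (left c h.some.y h.some.x) else ff L
  | _, neg c, _, _, l, r => neg (left c l r)
  | _, conj c, _, _, l, r => conj fun i => left (c i) l r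

end AC

/-! ### Rules and transformations -/

/-- A plain rule `L ← I → R` with both morphisms in `M`. -/
structure PlainRule (M : MorphismProperty C) where
  L : C
  I : C
  R : C
  l : I ⟶ L
  r : I ⟶ R
  l_mem : M l
  r_mem : M r

/-- A rule: a plain rule with an application condition on its left-hand side. -/
structure Rule (M : MorphismProperty C) where
  plain : PlainRule M
  ac : AC plain.L

variable {M : MorphismProperty C}

/-- A plain (i.e. AC-disregarding) direct transformation of `G` by `p`, with match `m` and
comatch `n`:
```
  L <--l-- I --r--> R
  |m       |i       |n
  G <--k-- D --c--> H
```
-/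
structure DirectTrans (p : PlainRule M) (G : C) where
  D : C
  H : C
  m : p.L ⟶ G
  i : p.I ⟶ D
  n : p.R ⟶ H
  k : D ⟶ G
  c : D ⟶ H
  left : IsPushout p.l i m k
  right : IsPushout p.r i n c

/-- A pair of plain (AC-disregarding) direct transformations `H₁ ⇐ G ⇒ H₂`. -/
structure PlainPair (p₁ p₂ : PlainRule M) where
  G : C
  t₁ : DirectTrans p₁ G
  t₂ : DirectTrans p₂ G

/-- A transformation pair via rules with ACs: both matches satisfy the ACs. -/
structure TransPair (ρ₁ ρ₂ : Rule M) extends PlainPair ρ₁.plain ρ₂.plain where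
  sat₁ : ρ₁.ac.Sat M t₁.m
  sat₂ : ρ₂.ac.Sat M t₂.m

/-- An extension diagram from `t` to `t'` (via the same rule) with extension morphism `f`. -/
@[ext]
structure Extension {p : PlainRule M} {G G' : C} (t : DirectTrans p G) (t' : DirectTrans p G')
    (f : G ⟶ G') where
  d : t.D ⟶ t'.D
  h : t.H ⟶ t'.H
  m_comp : t.m ≫ f = t'.m
  i_comp : t.i ≫ d = t'.i
  n_comp : t.n ≫ h = t'.n
  left : IsPushout t.k d f t'.k
  right : IsPushout t.c d h t'.c

/-- An embedding of `tp` into `tp'`: two extension diagrams with a common extension morphism. -/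
@[ext]
structure Embedding {p₁ p₂ : PlainRule M} (tp tp' : PlainPair p₁ p₂) where
  f : tp.G ⟶ tp'.G
  e₁ : Extension tp.t₁ tp'.t₁ f
  e₂ : Extension tp.t₂ tp'.t₂ f

/-- Isomorphic transformation pairs. -/
def PlainPair.Isomorphic {p₁ p₂ : PlainRule M} (tp tp' : PlainPair p₁ p₂) : Prop :=
  ∃ e : Embedding tp tp', IsIso e.f ∧ IsIso e.e₁.d ∧ IsIso e.e₁.h ∧ IsIso e.e₂.d ∧ IsIso e.e₂.h

/-- Parallel independence of plain transformation pairs. -/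
def PlainPair.ParallelIndependent {p₁ p₂ : PlainRule M} (tp : PlainPair p₁ p₂) : Prop :=
  (∃ d₁₂ : p₁.L ⟶ tp.t₂.D, d₁₂ ≫ tp.t₂.k = tp.t₁.m) ∧
  (∃ d₂₁ : p₂.L ⟶ tp.t₁.D, d₂₁ ≫ tp.t₁.k = tp.t₂.m)

/-- Plain transformation pairs in conflict. -/
def PlainPair.InConflict {p₁ p₂ : PlainRule M} (tp : PlainPair p₁ p₂) : Prop :=
  ¬ tp.ParallelIndependent

namespace TransPair

variable {ρ₁ ρ₂ : Rule M} (tp : TransPair ρ₁ ρ₂)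

/-- Parallel independence of transformation pairs via rules with ACs. -/
def ParallelIndependent : Prop :=
  (∃ d₁₂ : ρ₁.plain.L ⟶ tp.t₂.D, d₁₂ ≫ tp.t₂.k = tp.t₁.m ∧ ρ₁.ac.Sat M (d₁₂ ≫ tp.t₂.c)) ∧
  (∃ d₂₁ : ρ₂.plain.L ⟶ tp.t₁.D, d₂₁ ≫ tp.t₁.k = tp.t₂.m ∧ ρ₂.ac.Sat M (d₂₁ ≫ tp.t₁.c))

/-- Parallel dependent, i.e. conflicting, transformation pairs. -/
def InConflict : Prop := ¬ tp.ParallelIndependent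

def UseDelete : Prop := ¬ ∃ d₁₂ : ρ₁.plain.L ⟶ tp.t₂.D, d₁₂ ≫ tp.t₂.k = tp.t₁.m

def DeleteUse : Prop := ¬ ∃ d₂₁ : ρ₂.plain.L ⟶ tp.t₁.D, d₂₁ ≫ tp.t₁.k = tp.t₂.m

def ACProduce : Prop :=
  ∃ d₁₂ : ρ₁.plain.L ⟶ tp.t₂.D, d₁₂ ≫ tp.t₂.k = tp.t₁.m ∧ ¬ ρ₁.ac.Sat M (d₁₂ ≫ tp.t₂.c)

def ProduceAC : Prop :=
  ∃ d₂₁ : ρ₂.plain.L ⟶ tp.t₁.D, d₂₁ ≫ tp.t₁.k = tp.t₂.m ∧ ¬ ρ₂.ac.Sat M (d₂₁ ≫ tp.t₁.c)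

def ACConflict : Prop := tp.ACProduce ∨ tp.ProduceAC

end TransPair

/-! ### Initial transformation pairs for plain rules -/

/-- `tpI` is an initial transformation pair for `tp`. -/
def IsInitialFor {p₁ p₂ : PlainRule M} (tpI tp : PlainPair p₁ p₂) : Prop :=
  ∃ eI : Embedding tpI tp, ∀ (tp' : PlainPair p₁ p₂) (e : Embedding tp' tp),
    ∃! e' : Embedding tpI tp', e'.f ≫ e.f = eI.f

/-- The system with rule set `R` has initial transformation pairs for conflicts along the
underlying plain rules. -/
def HasInitialPairsForConflicts (R : Set (Rule M)) : Prop :=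
  ∀ ρ₁ ∈ R, ∀ ρ₂ ∈ R, ∀ tp : PlainPair ρ₁.plain ρ₂.plain, tp.InConflict →
    ∃ tpI : PlainPair ρ₁.plain ρ₂.plain, IsInitialFor tpI tp

/-- Initial conflicts for plain rules. -/
def PlainPair.IsInitialConflict {p₁ p₂ : PlainRule M} (tp : PlainPair p₁ p₂) : Prop :=
  tp.InConflict ∧ ∃ tpI : PlainPair p₁ p₂, IsInitialFor tpI tp ∧ tp.Isomorphic tpI

section Coproduct

variable [HasBinaryCoproducts C]

lemma isPushout_inr {A B : C} (f : A ⟶ B) (X : C) :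
    IsPushout f (coprod.inr : A ⟶ X ⨿ A) (coprod.inr : B ⟶ X ⨿ B) (coprod.map (𝟙 X) f) where
  w := by simp
  isColimit' := ⟨PushoutCocone.IsColimit.mk _
    (fun s => coprod.desc (coprod.inl ≫ s.inr) s.inl)
    (fun s => coprod.inr_desc _ _)
    (fun s => by
      refine coprod.hom_ext ?_ ?_
      · rw [coprod.inl_map_assoc, Category.id_comp]
        exact coprod.inl_desc _ _
      · rw [coprod.inr_map_assoc]
        exact (congrArg (f ≫ ·) (coprod.inr_desc _ _)).trans s.condition)
    (fun s m h₁ h₂ => by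
      refine coprod.hom_ext ?_ ?_
      · refine Eq.trans ?_ (coprod.inl_desc _ _).symm
        rw [← h₂, coprod.inl_map_assoc, Category.id_comp]
      · exact h₁.trans (coprod.inr_desc _ _).symm)⟩

/-- The transformation pair `R₁ + L₂ ⇐ L₁ + L₂ ⇒ L₁ + R₂` at the coproduct injections. -/
noncomputable def coprodPair (p₁ p₂ : PlainRule M) : PlainPair p₁ p₂ where
  G := p₁.L ⨿ p₂.L
  t₁ :=
    { D := p₁.I ⨿ p₂.L
      H := p₁.R ⨿ p₂.L
      m := coprod.inl
      i := coprod.inl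
      n := coprod.inl
      k := coprod.map p₁.l (𝟙 p₂.L)
      c := coprod.map p₁.r (𝟙 p₂.L)
      left := (IsPushout.of_coprod_inl_with_id p₁.l p₂.L).flip
      right := (IsPushout.of_coprod_inl_with_id p₁.r p₂.L).flip }
  t₂ :=
    { D := p₁.L ⨿ p₂.I
      H := p₁.L ⨿ p₂.R
      m := coprod.inr
      i := coprod.inr
      n := coprod.inr
      k := coprod.map (𝟙 p₁.L) p₂.l
      c := coprod.map (𝟙 p₁.L) p₂.r
      left := isPushout_inr p₂.l p₁.L
      right := isPushout_inr p₂.r p₁.L }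

/-- Initial parallel independent transformation pairs. -/
def PlainPair.IsInitialParallelIndependent {p₁ p₂ : PlainRule M} (tp : PlainPair p₁ p₂) : Prop :=
  tp.ParallelIndependent ∧ tp.Isomorphic (coprodPair p₁ p₂)

end Coproduct

/-! ### Symbolic transformation pairs -/

section Symbolic

variable (E : PairClass C) {ρ₁ ρ₂ : Rule M} (tp : PlainPair ρ₁.plain ρ₂.plain)

/-- The extension AC `ac_K = Shift(o₁, ac_{L₁}) ∧ Shift(o₂, ac_{L₂})`. -/
def extensionAC : AC tp.G :=
  (ρ₁.ac.shift E M tp.t₁.m).and (ρ₂.ac.shift E M tp.t₂.m)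

open Classical in
/-- `ac*_{K,d₁₂}`. -/
noncomputable def conflictAC₁₂ : AC tp.G :=
  if h : ∃ d₁₂ : ρ₁.plain.L ⟶ tp.t₂.D, d₁₂ ≫ tp.t₂.k = tp.t₁.m then
    (ρ₁.ac.shift E M (h.choose ≫ tp.t₂.c)).left tp.t₂.k tp.t₂.c
  else AC.ff tp.G

open Classical in
/-- `ac*_{K,d₂₁}`. -/
noncomputable def conflictAC₂₁ : AC tp.G :=
  if h : ∃ d₂₁ : ρ₂.plain.L ⟶ tp.t₁.D, d₂₁ ≫ tp.t₁.k = tp.t₂.m then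
    (ρ₂.ac.shift E M (h.choose ≫ tp.t₁.c)).left tp.t₁.k tp.t₁.c
  else AC.ff tp.G

/-- The conflict-inducing AC `ac*_K = ¬(ac*_{K,d₁₂} ∧ ac*_{K,d₂₁})`. -/
noncomputable def conflictAC : AC tp.G :=
  ((conflictAC₁₂ E tp).and (conflictAC₂₁ E tp)).neg

end Symbolic

/-- Symbolic transformation pairs `⟨tp_K, ac_K, ac*_K⟩` for `⟨ρ₁, ρ₂⟩`. -/
structure SymbolicPair (E : PairClass C) (ρ₁ ρ₂ : Rule M) where
  tp : PlainPair ρ₁.plain ρ₂.plain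
  ac : AC tp.G
  acStar : AC tp.G
  ac_eq : ac = extensionAC E tp
  acStar_eq : acStar = conflictAC E tp

namespace SymbolicPair

variable {E : PairClass C} {ρ₁ ρ₂ : Rule M}

/-- The unfolding: all transformation pairs (satisfying the ACs) into which `tp_K` embeds. -/
def unfolding (stp : SymbolicPair E ρ₁ ρ₂) : Set (TransPair ρ₁ ρ₂) :=
  {tp | Nonempty (Embedding stp.tp tp.toPlainPair)}

def ConflictInducing (stp : SymbolicPair E ρ₁ ρ₂) : Prop :=
  ∃ tp ∈ stp.unfolding, tp.InConflict

/-- `stp` embeds into `tp` by an extension diagram whose extension morphism `m` satisfies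
`ac_K ∧ ac*_K`. -/
def Covers (stp : SymbolicPair E ρ₁ ρ₂) (tp : TransPair ρ₁ ρ₂) : Prop :=
  ∃ e : Embedding stp.tp tp.toPlainPair, (stp.ac.and stp.acStar).Sat M e.f

/-- Use-delete/delete-use initial conflicts. -/
def IsUseDeleteInitialConflict (stp : SymbolicPair E ρ₁ ρ₂) : Prop :=
  stp.ConflictInducing ∧ stp.tp.IsInitialConflict

/-- AC initial conflicts. -/
def IsACInitialConflict [HasBinaryCoproducts C] (stp : SymbolicPair E ρ₁ ρ₂) : Prop :=
  stp.ConflictInducing ∧ stp.tp.IsInitialParallelIndependent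

/-- Initial conflicts for rules with ACs. -/
def IsInitialConflict [HasBinaryCoproducts C] (stp : SymbolicPair E ρ₁ ρ₂) : Prop :=
  stp.IsUseDeleteInitialConflict ∨ stp.IsACInitialConflict

end SymbolicPair

/-- Completeness of a set of symbolic transformation pairs w.r.t. parallel dependence. -/
def IsComplete {E : PairClass C} {ρ₁ ρ₂ : Rule M} (S : Set (SymbolicPair E ρ₁ ρ₂)) : Prop :=
  ∀ tp : TransPair ρ₁ ρ₂, tp.InConflict → ∃ stp ∈ S, stp.Covers tp

end Categories

end MAdhesive

/-! Whatever pair on `K` embeds into a given parallel dependent pair, its symbolic pair covers that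
pair (`SymbolicPair.ofPlainPair_covers`); only a suitable embedding has to be found. For covering,
`AC.sat_shift` turns `ac_K` at the extension morphism into the rule ACs at the large matches. By
`AC.sat_left`, applied to the extension diagram as a double pushout, `ac*_{K,d₁₂} ∧ ac*_{K,d₂₁}`
would yield parallel independence of the large pair, so its negation holds. Neither equivalence asks
the extension morphism to lie in `M`. The embedding depends on the plain pair. If it is in conflict,
its initial pair embeds; conflicts pass down along embeddings and initial pairs are initial for
themselves (`IsInitialFor.self`), so this is a plain initial conflict. If it is parallel
independent, the copairing of the two matches extends `coprodPair`. `AC.sat_left` rests on the van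
Kampen property: double pushouts restrict along `M`-morphisms, and pushout complements are unique.
-/

namespace MAdhesive

/-! ### Pushouts, pullbacks and pushout complements along `M`-morphisms. -/

namespace IsMAdhesive

variable {C : Type u} [Category.{v} C] {M : MorphismProperty C}

lemma id_mem (hM : IsMAdhesive M) (X : C) : M (𝟙 X) := hM.iso _ inferInstance

/-- Pushouts along `M`-morphisms are pullbacks. -/
lemma isPullback_of_isPushout (hM : IsMAdhesive M) {W X Y Z : C} {f : W ⟶ X} {g : W ⟶ Y}
    {h : X ⟶ Z} {i : Y ⟶ Z} (hp : IsPushout f g h i) (hf : M f) : IsPullback g f i h := by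
  have := hM.mono f hf
  -- The top face is the trivial pushout of `g` along `𝟙 W`, with vertical morphisms `𝟙 W`, `f`, `𝟙
  -- Y`, `i`; the front face over `h` is the required pullback.
  exact ((hM.vanKampen f g h i hp hf (𝟙 W) g g (𝟙 Y) (𝟙 W) f (𝟙 Y) i
    (hM.id_mem W) hf (hM.id_mem Y) (hM.pushout_closed f g h i hp hf)
    (IsPullback.of_horiz_isIso_mono ⟨rfl⟩) IsPullback.of_id_snd
    ⟨hp.w.symm⟩ ⟨rfl⟩ ⟨by simp⟩).1 (IsPushout.id_horiz g)).1

/-- The `M`-pushout-pullback decomposition property: if a pushout along an `M`-morphism `r` is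
cut by a pullback along an `M`-morphism `q`, then the remaining square is a pushout. -/
lemma isPushout_of_isPullback (hM : IsMAdhesive M) {I R X Z D H : C} {r : I ⟶ R} {i : I ⟶ Z}
    {a : R ⟶ X} {x : Z ⟶ X} {z : Z ⟶ D} {q : X ⟶ H} {c : D ⟶ H}
    (hp : IsPushout r (i ≫ z) (a ≫ q) c) (hpb : IsPullback x z q c) (w : r ≫ a = i ≫ x)
    (hr : M r) (hq : M q) : IsPushout r i a x := by
  have hz : M z := hM.pullback_closed _ _ _ _ hpb hq
  have := hM.mono q hq
  have := hM.mono z hz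
  -- The vertical morphisms are `𝟙 I`, `𝟙 R`, `z`, `q`. The faces with an identity are pullbacks
  -- because `z` and `q` are monic, and `hpb` is the remaining front face.
  refine (hM.vanKampen r (i ≫ z) (a ≫ q) c hp hr r i a x (𝟙 I) (𝟙 R) z q
    (hM.id_mem I) (hM.id_mem R) hz hq IsPullback.of_id_snd ?_ ⟨by simp⟩ ⟨hpb.w⟩ ⟨w⟩).2 ⟨?_, hpb⟩
  · exact IsPullback.of_right (t := IsPullback.of_id_fst (f := z)) (by
      simpa using IsPullback.of_vert_isIso_mono (snd := 𝟙 I) (f := z) ⟨by simp⟩) (by simp)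
  · exact IsPullback.of_vert_isIso_mono ⟨by simp⟩

/-- Pushout complements of `M`-morphisms are unique. -/
lemma exists_iso_pushoutComplement (hM : IsMAdhesive M) {I R X Z Z' : C} {r : I ⟶ R}
    {a : R ⟶ X} {i : I ⟶ Z} {x : Z ⟶ X} {i' : I ⟶ Z'} {x' : Z' ⟶ X}
    (hp : IsPushout r i a x) (hp' : IsPushout r i' a x') (hr : M r) :
    ∃ e : Z ≅ Z', i ≫ e.hom = i' ∧ e.hom ≫ x' = x := by
  have hx : M x := hM.pushout_closed _ _ _ _ hp hr
  have hx' : M x' := hM.pushout_closed _ _ _ _ hp' hr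
  have := hM.mono x' hx'
  -- Both projections from the pullback of two complements are isomorphisms; by symmetry one
  -- projection suffices.
  have key : ∀ {Z Z' U : C} {i : I ⟶ Z} {x : Z ⟶ X} {i' : I ⟶ Z'} {x' : Z' ⟶ X}
      {s : U ⟶ Z} {t : U ⟶ Z'}, IsPushout r i a x → IsPushout r i' a x' →
      IsPullback s t x x' → IsIso t := by
    intro Z Z' U i x i' x' s t hp hp' hU
    have hx' : M x' := hM.pushout_closed _ _ _ _ hp' hr
    have hs : M s := hM.pullback_closed _ _ _ _ hU.flip hx'
    have := hM.mono r hr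
    let u : I ⟶ U := hU.lift i i' (hp.w.symm.trans hp'.w)
    have hu : u ≫ s = i := hU.lift_fst _ _ _
    have hu' : u ≫ t = i' := hU.lift_snd _ _ _
    have h₁ : IsPullback i' r x' a := hM.isPullback_of_isPushout hp' hr
    have h₂ : IsPullback (𝟙 I) (𝟙 I) r r := IsPullback.of_horiz_isIso_mono ⟨rfl⟩
    have h₃ : IsPullback (u ≫ t) (𝟙 I) x' (i ≫ x) := by
      have := h₂.paste_horiz h₁
      rwa [Category.id_comp, hp.w, ← hu'] at this
    have h₄ : IsPullback u (𝟙 I) s i := IsPullback.of_right h₃ (by simp [hu]) hU.flip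
    -- A cube over `hp` pulled back along `x'`: its top face exhibits `t` as a pushout of `𝟙 I`.
    have top : IsPushout (𝟙 I) u i' t :=
      (hM.vanKampen r i a x hp hr (𝟙 I) u i' t (𝟙 I) r s x' (hM.id_mem I) hr hs hx'
        h₂ h₄ ⟨h₁.w⟩ ⟨hU.w.symm⟩ ⟨by simp [hu']⟩).2 ⟨h₁, hU.flip⟩
    exact top.isIso_inr_of_isIso
  have := hM.hasPullback x x' hx
  have hU := IsPullback.of_hasPullback x x'
  have := key hp hp' hU
  have := key hp' hp hU.flip
  have hw : (inv (pullback.fst x x') ≫ pullback.snd x x') ≫ x' = x := by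
    rw [Category.assoc, ← hU.w, IsIso.inv_hom_id_assoc]
  refine ⟨(asIso (pullback.fst x x')).symm ≪≫ asIso (pullback.snd x x'), ?_, hw⟩
  rw [← cancel_mono x', Category.assoc]
  simp only [Iso.trans_hom, Iso.symm_hom, asIso_inv, asIso_hom]
  rw [hw, ← hp.w, hp'.w]

/-- A pushout along an `M`-morphism whose comatch factors through an `M`-morphism `q` restricts
to a pushout along the first factor. -/
lemma exists_restriction (hM : IsMAdhesive M) {I R X D H : C} {r : I ⟶ R} {j : I ⟶ D}
    {a : R ⟶ X} {q : X ⟶ H} {c : D ⟶ H} (hp : IsPushout r j (a ≫ q) c) (hr : M r) (hq : M q) :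
    ∃ (Z : C) (i : I ⟶ Z) (x : Z ⟶ X) (z : Z ⟶ D),
      IsPushout r i a x ∧ i ≫ z = j ∧ x ≫ q = z ≫ c := by
  have := hM.hasPullback q c hq
  have hU := IsPullback.of_hasPullback q c
  let i : I ⟶ pullback q c := hU.lift (r ≫ a) j (by simpa using hp.w)
  have hi : i ≫ pullback.snd q c = j := hU.lift_snd _ _ _
  refine ⟨_, i, _, _, ?_, hi, hU.w⟩
  exact hM.isPushout_of_isPullback (by rwa [hi]) hU (hU.lift_fst _ _ _).symm hr hq

/-- Two double pushouts over the same span of `M`-morphisms, the match of the second factoring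
through the match of the first via an `M`-morphism `p`, are related by an extension diagram. -/
lemma exists_extension (hM : IsMAdhesive M) {L I R Y Z X G D H : C} {l : I ⟶ L} {r : I ⟶ R}
    {b : L ⟶ Y} {i : I ⟶ Z} {y : Z ⟶ Y} {a : R ⟶ X} {x : Z ⟶ X}
    {p : Y ⟶ G} {j : I ⟶ D} {k : D ⟶ G} {n : R ⟶ H} {c : D ⟶ H}
    (hl : M l) (hp : M p) (left : IsPushout l i b y) (right : IsPushout r i a x)
    (left' : IsPushout l j (b ≫ p) k) (right' : IsPushout r j n c) :
    ∃ (z : Z ⟶ D) (q : X ⟶ H), M q ∧ a ≫ q = n ∧ IsPushout y z p k ∧ IsPushout x z q c := by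
  -- Restricting the large left pushout along `p` gives a complement of `(l, b)`, which uniqueness
  -- identifies with the given `Z`.
  obtain ⟨Z', i', y', z', hi', hz', hw'⟩ := hM.exists_restriction left' hl hp
  obtain ⟨e, he, he'⟩ := hM.exists_iso_pushoutComplement left hi' hl
  have hj : i ≫ e.hom ≫ z' = j := by rw [← Category.assoc, he, hz']
  have h₁ : IsPushout y (e.hom ≫ z') p k := by
    refine IsPushout.of_top (v₁₁ := i) (by rwa [hj]) ?_ left
    rw [← he', Category.assoc, hw', Category.assoc]
  have hy : M y := hM.pushout_closed _ _ _ _ left hl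
  -- Membership in `M` travels from `p` to `z` by pullback, and from `z` to `q` by pushout.
  have hz : M (e.hom ≫ z') :=
    hM.pullback_closed _ _ _ _ (hM.isPullback_of_isPushout h₁ hy).flip hp
  have hw : r ≫ n = i ≫ (e.hom ≫ z') ≫ c := by
    rw [right'.w, ← hj]
    simp only [Category.assoc]
  have h₂ : IsPushout x (e.hom ≫ z') (right.desc n _ hw) c :=
    IsPushout.of_top (v₁₁ := i) (v₁₂ := a) (by rwa [hj, right.inl_desc])
      (right.inr_desc _ _ _) right
  exact ⟨_, _, hM.pushout_closed _ _ _ _ h₂.flip hz, right.inl_desc _ _ _, h₁, h₂⟩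

end IsMAdhesive

/-! ### Semantics of `shift` and `left`. -/

namespace AC

variable {C : Type u} [Category.{v} C] {M : MorphismProperty C}

lemma sat_ex {P Q G : C} (a : P ⟶ Q) (c : AC Q) (p : P ⟶ G) :
    (ex a c).Sat M p ↔ ∃ q : Q ⟶ G, M q ∧ a ≫ q = p ∧ c.Sat M q := Iff.rfl

lemma sat_neg {P G : C} (c : AC P) (p : P ⟶ G) : (neg c).Sat M p ↔ ¬ c.Sat M p := Iff.rfl

lemma sat_conj {P G : C} {I : Type (max u v)} (c : I → AC P) (p : P ⟶ G) :
    (conj c).Sat M p ↔ ∀ i, (c i).Sat M p := Iff.rfl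

lemma sat_disj {P G : C} {I : Type (max u v)} (c : I → AC P) (p : P ⟶ G) :
    (disj c).Sat M p ↔ ∃ i, (c i).Sat M p := by
  simp [disj, sat_neg, sat_conj]

lemma sat_and {P G : C} (c c' : AC P) (p : P ⟶ G) :
    (c.and c').Sat M p ↔ c.Sat M p ∧ c'.Sat M p := by
  simp [AC.and, sat_conj, ULift.forall, and_comm]

lemma not_sat_ff {P G : C} (p : P ⟶ G) : ¬ (ff P).Sat M p := by
  simp [ff, tt, sat_neg, sat_conj]

/-- `p ⊨ Shift(b, c)` iff `p ∘ b ⊨ c`. -/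
lemma sat_shift (hM : IsMAdhesive M) {E : PairClass C} (hE : HasUniquePairFactorization E M)
    {P : C} (c : AC P) {P' G : C} (b : P ⟶ P') (p : P' ⟶ G) :
    (c.shift E M b).Sat M p ↔ c.Sat M (b ≫ p) := by
  induction c generalizing P' G with
  | @ex P Q a c ih =>
    rw [shift, sat_disj, sat_ex]
    simp only [sat_ex, ih]
    constructor
    · rintro ⟨s, q, hq, rfl, hs⟩
      exact ⟨s.b' ≫ q, hM.comp _ _ s.mem_M hq, by rw [← Category.assoc, s.w, Category.assoc], hs⟩
    · rintro ⟨q, hq, hw, hs⟩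
      -- Factoring the pair `(p, q)` produces the disjunct: `e₂` is in `M` by decomposition, since
      -- `e₂ ≫ m = q`, and the square commutes after cancelling `m`.
      obtain ⟨⟨K, e₁, e₂, m, he, hm, h₁, h₂⟩, -⟩ := hE p q
      have := hM.mono m hm
      refine ⟨⟨K, e₁, e₂, he, hM.decomp e₂ m (by rwa [h₂]) hm, ?_⟩, m, hm, h₁, by rwa [h₂]⟩
      rw [← cancel_mono m, Category.assoc, h₂, hw, Category.assoc, h₁]
  | neg c ih => rw [shift, sat_neg, sat_neg, ih]
  | conj c ih =>
    rw [shift, sat_conj, sat_conj]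
    exact forall_congr' fun i => ih i b p

/-- The match of a double pushout satisfies `Left(ρ, c)` iff its comatch satisfies `c`. -/
lemma sat_left (hM : IsMAdhesive M) {R : C} (ac : AC R) {L I G D H : C} {l : I ⟶ L} {r : I ⟶ R}
    {m : L ⟶ G} {j : I ⟶ D} {k : D ⟶ G} {n : R ⟶ H} {c : D ⟶ H} (hl : M l) (hr : M r)
    (left : IsPushout l j m k) (right : IsPushout r j n c) :
    (ac.left l r).Sat M m ↔ ac.Sat M n := by
  induction ac generalizing L I G D H with
  | @ex R X a ac ih =>
    rw [AC.left, sat_ex]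
    split_ifs with h
    -- The argument works for any completion, so the choice made in `left` is immaterial.
    · generalize h.some = s
      have hy : M s.y := hM.pushout_closed _ _ _ _ s.left hl
      have hx : M s.x := hM.pushout_closed _ _ _ _ s.right hr
      rw [sat_ex]
      constructor
      · rintro ⟨p, hp, rfl, hs⟩
        obtain ⟨z, q, hq, rfl, h₁, h₂⟩ := hM.exists_extension hl hp s.left s.right left right
        exact ⟨q, hq, rfl, (ih hy hx h₁ h₂).1 hs⟩
      · rintro ⟨q, hq, rfl, hs⟩
        -- The same extension lemma, with the double pushouts read from right to left.
        obtain ⟨z, p, hp, rfl, h₁, h₂⟩ := hM.exists_extension hr hq s.right s.left right left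
        exact ⟨p, hp, rfl, (ih hy hx h₂ h₁).2 hs⟩
    · refine iff_of_false (not_sat_ff _) ?_
      rintro ⟨q, hq, rfl, -⟩
      -- A witness `q` would restrict the right pushout to a complement of `(r, a)`; pushing out
      -- along `l` would then give the excluded completion.
      obtain ⟨Z, i, x, -, hi, -⟩ := hM.exists_restriction right hr hq
      have := hM.hasPushout l i hl
      exact h ⟨⟨_, Z, _, i, _, x, hi, IsPushout.of_hasPushout l i⟩⟩
  | neg ac ih => rw [AC.left, sat_neg, sat_neg, ih hl hr left right]
  | conj ac ih =>
    rw [AC.left, sat_conj, sat_conj]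
    exact forall_congr' fun i => ih i hl hr left right

end AC

/-! ### Embeddings of plain pairs and initiality. -/

section Embeddings

variable {C : Type u} [Category.{v} C] {M : MorphismProperty C}

/-- The identity extension diagram. -/
def Extension.refl {p : PlainRule M} {G : C} (t : DirectTrans p G) : Extension t t (𝟙 G) where
  d := 𝟙 _
  h := 𝟙 _
  m_comp := Category.comp_id _
  i_comp := Category.comp_id _
  n_comp := Category.comp_id _
  left := IsPushout.of_id_snd
  right := IsPushout.of_id_snd

/-- Vertical composition of extension diagrams. -/
def Extension.comp {p : PlainRule M} {G G' G'' : C} {t : DirectTrans p G} {t' : DirectTrans p G'}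
    {t'' : DirectTrans p G''} {f : G ⟶ G'} {f' : G' ⟶ G''} (e : Extension t t' f)
    (e' : Extension t' t'' f') : Extension t t'' (f ≫ f') where
  d := e.d ≫ e'.d
  h := e.h ≫ e'.h
  m_comp := by rw [← Category.assoc, e.m_comp, e'.m_comp]
  i_comp := by rw [← Category.assoc, e.i_comp, e'.i_comp]
  n_comp := by rw [← Category.assoc, e.n_comp, e'.n_comp]
  left := e.left.paste_vert e'.left
  right := e.right.paste_vert e'.right

variable {p₁ p₂ : PlainRule M}

/-- The identity embedding. -/
def Embedding.refl (tp : PlainPair p₁ p₂) : Embedding tp tp where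
  f := 𝟙 _
  e₁ := Extension.refl _
  e₂ := Extension.refl _

/-- Composition of embeddings. -/
def Embedding.comp {tp tp' tp'' : PlainPair p₁ p₂} (e : Embedding tp tp')
    (e' : Embedding tp' tp'') : Embedding tp tp'' where
  f := e.f ≫ e'.f
  e₁ := e.e₁.comp e'.e₁
  e₂ := e.e₂.comp e'.e₂

lemma PlainPair.Isomorphic.refl (tp : PlainPair p₁ p₂) : tp.Isomorphic tp :=
  ⟨Embedding.refl tp, inferInstanceAs (IsIso (𝟙 _)), inferInstanceAs (IsIso (𝟙 _)),
    inferInstanceAs (IsIso (𝟙 _)), inferInstanceAs (IsIso (𝟙 _)), inferInstanceAs (IsIso (𝟙 _))⟩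

/-- For `e` into `tpI`, initiality applied to `e.comp eI` gives `e'`. Then `e'.comp e` and the
identity are both lifts of `eI` through itself, so they agree. -/
lemma IsInitialFor.self {tpI tp : PlainPair p₁ p₂} (h : IsInitialFor tpI tp) :
    IsInitialFor tpI tpI := by
  obtain ⟨eI, hI⟩ := h
  refine ⟨Embedding.refl tpI, fun tp' e => ?_⟩
  obtain ⟨e', he', huniq⟩ := hI tp' (e.comp eI)
  obtain ⟨s, -, hs⟩ := hI tpI eI
  refine ⟨e', ?_, fun e'' he'' => huniq e'' ?_⟩
  · have h₁ : e'.comp e = s := hs _ ((Category.assoc _ _ _).trans he')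
    have h₂ : Embedding.refl tpI = s := hs _ (Category.id_comp _)
    exact congrArg Embedding.f (h₁.trans h₂.symm)
  · refine (Category.assoc _ _ _).symm.trans ?_
    rw [he'']
    exact Category.id_comp _

/-- The context morphisms of the embedding carry `d₁₂` and `d₂₁` along. Used contrapositively: a
pair embedded into a plain conflict is itself in conflict. -/
lemma Embedding.parallelIndependent {tp tp' : PlainPair p₁ p₂} (e : Embedding tp tp')
    (h : tp.ParallelIndependent) : tp'.ParallelIndependent := by
  obtain ⟨⟨d, hd⟩, d', hd'⟩ := h
  refine ⟨⟨d ≫ e.e₂.d, ?_⟩, d' ≫ e.e₁.d, ?_⟩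
  · rw [Category.assoc, ← e.e₂.left.w, ← Category.assoc, hd, e.e₁.m_comp]
  · rw [Category.assoc, ← e.e₁.left.w, ← Category.assoc, hd', e.e₂.m_comp]

end Embeddings

/-! ### The pair at the coproduct injections. -/

section Coproduct

variable {C : Type u} [Category.{v} C] [HasBinaryCoproducts C] {M : MorphismProperty C}
  {p₁ p₂ : PlainRule M}

/-- Pushout cancellation: pasting with the coproduct square along `coprod.inl` recovers `h`. With
`A` the other left-hand side, this supplies both squares of an extension diagram. -/
lemma isPushout_coprod_desc_inl {I L D G A : C} {l : I ⟶ L} {i : I ⟶ D} {m : L ⟶ G} {k : D ⟶ G}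
    (h : IsPushout l i m k) (d : A ⟶ D) (o : A ⟶ G) (w : d ≫ k = o) :
    IsPushout (coprod.map l (𝟙 A)) (coprod.desc i d) (coprod.desc m o) k := by
  refine IsPushout.of_top (v₁₁ := coprod.inl) (v₁₂ := coprod.inl) ?_ ?_
    (IsPushout.of_coprod_inl_with_id l A).flip
  · rwa [coprod.inl_desc, coprod.inl_desc]
  · rw [coprod.map_desc, coprod.desc_comp, Category.id_comp, h.w, w]

lemma isPushout_coprod_desc_inr {I L D G A : C} {l : I ⟶ L} {i : I ⟶ D} {m : L ⟶ G} {k : D ⟶ G}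
    (h : IsPushout l i m k) (d : A ⟶ D) (o : A ⟶ G) (w : d ≫ k = o) :
    IsPushout (coprod.map (𝟙 A) l) (coprod.desc d i) (coprod.desc o m) k := by
  refine IsPushout.of_top (v₁₁ := coprod.inr) (v₁₂ := coprod.inr) ?_ ?_ (isPushout_inr l A)
  · rwa [coprod.inr_desc, coprod.inr_desc]
  · rw [coprod.map_desc, coprod.desc_comp, Category.id_comp, h.w, w]

/-- The pair at the coproduct injections embeds into every plain parallel independent pair. -/
lemma PlainPair.ParallelIndependent.nonempty_embedding {tp : PlainPair p₁ p₂}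
    (h : tp.ParallelIndependent) : Nonempty (Embedding (coprodPair p₁ p₂) tp) := by
  obtain ⟨⟨d, hd⟩, d', hd'⟩ := h
  exact ⟨{
    f := coprod.desc tp.t₁.m tp.t₂.m
    e₁ :=
      { d := coprod.desc tp.t₁.i d'
        h := coprod.desc tp.t₁.n (d' ≫ tp.t₁.c)
        m_comp := coprod.inl_desc _ _
        i_comp := coprod.inl_desc _ _
        n_comp := coprod.inl_desc _ _
        left := isPushout_coprod_desc_inl tp.t₁.left d' _ hd'
        right := isPushout_coprod_desc_inl tp.t₁.right d' _ rfl }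
    e₂ :=
      { d := coprod.desc d tp.t₂.i
        h := coprod.desc (d ≫ tp.t₂.c) tp.t₂.n
        m_comp := coprod.inr_desc _ _
        i_comp := coprod.inr_desc _ _
        n_comp := coprod.inr_desc _ _
        left := isPushout_coprod_desc_inr tp.t₂.left d _ hd
        right := isPushout_coprod_desc_inr tp.t₂.right d _ rfl } }⟩

lemma coprodPair_isInitialParallelIndependent :
    (coprodPair p₁ p₂).IsInitialParallelIndependent := by
  refine ⟨⟨⟨coprod.inl, ?_⟩, coprod.inr, ?_⟩, PlainPair.Isomorphic.refl _⟩
  · exact (coprod.inl_map _ _).trans (Category.id_comp _)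
  · exact (coprod.inr_map _ _).trans (Category.id_comp _)

end Coproduct

/-! ### Symbolic pairs and covering. -/

section Symbolic

variable {C : Type u} [Category.{v} C] {M : MorphismProperty C} {E : PairClass C}
  {ρ₁ ρ₂ : Rule M}

lemma DirectTrans.k_mem (hM : IsMAdhesive M) {p : PlainRule M} {G : C} (t : DirectTrans p G) :
    M t.k := hM.pushout_closed _ _ _ _ t.left p.l_mem

lemma DirectTrans.c_mem (hM : IsMAdhesive M) {p : PlainRule M} {G : C} (t : DirectTrans p G) :
    M t.c := hM.pushout_closed _ _ _ _ t.right p.r_mem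

/-- Along an extension diagram, `Left(ρ, Shift(d ; c, ac))` expresses that `ac` holds after the
larger transformation. -/
lemma Extension.sat_left_shift (hM : IsMAdhesive M) (hE : HasUniquePairFactorization E M)
    {p : PlainRule M} {G G' L : C} {t : DirectTrans p G} {t' : DirectTrans p G'} {f : G ⟶ G'}
    (e : Extension t t' f) (d : L ⟶ t.D) (ac : AC L) :
    ((ac.shift E M (d ≫ t.c)).left t.k t.c).Sat M f ↔ ac.Sat M ((d ≫ e.d) ≫ t'.c) := by
  rw [AC.sat_left hM _ (t.k_mem hM) (t.c_mem hM) e.left e.right, AC.sat_shift hM hE,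
    Category.assoc, e.right.w, Category.assoc]

/-- The condition is not `false`, so `K` has a `d₁₂`; composed with the context morphism of `e.e₂`
it is the required witness. -/
lemma Embedding.exists_of_sat_conflictAC₁₂ (hM : IsMAdhesive M)
    (hE : HasUniquePairFactorization E M) {tp tp' : PlainPair ρ₁.plain ρ₂.plain}
    (e : Embedding tp tp') (h : (conflictAC₁₂ E tp).Sat M e.f) :
    ∃ d : ρ₁.plain.L ⟶ tp'.t₂.D, d ≫ tp'.t₂.k = tp'.t₁.m ∧ ρ₁.ac.Sat M (d ≫ tp'.t₂.c) := by
  unfold conflictAC₁₂ at h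
  split_ifs at h with hd
  · refine ⟨_, ?_, (e.e₂.sat_left_shift hM hE _ _).1 h⟩
    rw [Category.assoc, ← e.e₂.left.w, ← Category.assoc, hd.choose_spec, e.e₁.m_comp]
  · exact (AC.not_sat_ff _ h).elim

lemma Embedding.exists_of_sat_conflictAC₂₁ (hM : IsMAdhesive M)
    (hE : HasUniquePairFactorization E M) {tp tp' : PlainPair ρ₁.plain ρ₂.plain}
    (e : Embedding tp tp') (h : (conflictAC₂₁ E tp).Sat M e.f) :
    ∃ d : ρ₂.plain.L ⟶ tp'.t₁.D, d ≫ tp'.t₁.k = tp'.t₂.m ∧ ρ₂.ac.Sat M (d ≫ tp'.t₁.c) := by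
  unfold conflictAC₂₁ at h
  split_ifs at h with hd
  · refine ⟨_, ?_, (e.e₁.sat_left_shift hM hE _ _).1 h⟩
    rw [Category.assoc, ← e.e₁.left.w, ← Category.assoc, hd.choose_spec, e.e₂.m_comp]
  · exact (AC.not_sat_ff _ h).elim

/-- The symbolic transformation pair of a plain pair. -/
noncomputable def SymbolicPair.ofPlainPair (E : PairClass C) (tp : PlainPair ρ₁.plain ρ₂.plain) :
    SymbolicPair E ρ₁ ρ₂ :=
  ⟨tp, extensionAC E tp, conflictAC E tp, rfl, rfl⟩

/-- A symbolic pair covers every parallel dependent pair it embeds into. -/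
lemma SymbolicPair.ofPlainPair_covers (hM : IsMAdhesive M) (hE : HasUniquePairFactorization E M)
    {tpK : PlainPair ρ₁.plain ρ₂.plain} {tp : TransPair ρ₁ ρ₂}
    (e : Embedding tpK tp.toPlainPair) (h : tp.InConflict) :
    (SymbolicPair.ofPlainPair E tpK).Covers tp := by
  -- The conflict condition is a negation, so `hs` satisfies both conjuncts, which together
  -- contradict `h`.
  refine ⟨e, (AC.sat_and _ _ _).2 ⟨(AC.sat_and _ _ _).2 ⟨?_, ?_⟩, fun hs => h ?_⟩⟩
  · exact (AC.sat_shift hM hE _ _ _).2 (by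
      have := tp.sat₁
      rwa [← e.e₁.m_comp] at this)
  · exact (AC.sat_shift hM hE _ _ _).2 (by
      have := tp.sat₂
      rwa [← e.e₂.m_comp] at this)
  · replace hs := (AC.sat_and _ _ _).1 hs
    exact ⟨e.exists_of_sat_conflictAC₁₂ hM hE hs.1, e.exists_of_sat_conflictAC₂₁ hM hE hs.2⟩

lemma TransPair.inConflict_of_useDelete_or_deleteUse {tp : TransPair ρ₁ ρ₂}
    (h : tp.UseDelete ∨ tp.DeleteUse) : tp.toPlainPair.InConflict :=
  fun hp => h.elim (fun h => h hp.1) (fun h => h hp.2)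

lemma TransPair.parallelIndependent_of_not {tp : TransPair ρ₁ ρ₂}
    (h : ¬ (tp.UseDelete ∨ tp.DeleteUse)) : tp.toPlainPair.ParallelIndependent :=
  ⟨not_not.1 fun h' => h (Or.inl h'), not_not.1 fun h' => h (Or.inr h')⟩

lemma TransPair.ParallelIndependent.toPlainPair {tp : TransPair ρ₁ ρ₂}
    (h : tp.ParallelIndependent) : tp.toPlainPair.ParallelIndependent :=
  ⟨h.1.imp fun _ hd => hd.1, h.2.imp fun _ hd => hd.1⟩

/-- Each `k` is monic, so `d₁₂` and `d₂₁` are unique; one that violates its AC rules out any that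
satisfies it. -/
lemma TransPair.ACConflict.inConflict (hM : IsMAdhesive M) {tp : TransPair ρ₁ ρ₂}
    (h : tp.ACConflict) : tp.InConflict := by
  have := hM.mono _ (tp.t₁.k_mem hM)
  have := hM.mono _ (tp.t₂.k_mem hM)
  rintro ⟨⟨d, hd, hs⟩, d', hd', hs'⟩
  rcases h with ⟨x, hx, hn⟩ | ⟨x, hx, hn⟩
  · rw [(cancel_mono _).1 (hx.trans hd.symm)] at hn
    exact hn hs
  · rw [(cancel_mono _).1 (hx.trans hd'.symm)] at hn
    exact hn hs'

/-- Use-delete and delete-use conflicts are covered by use-delete/delete-use initial conflicts. -/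
lemma exists_useDeleteInitialConflict (hM : IsMAdhesive M) (hE : HasUniquePairFactorization E M)
    {R : Set (Rule M)} (hR : HasInitialPairsForConflicts R) (h₁ : ρ₁ ∈ R) (h₂ : ρ₂ ∈ R)
    {tp : TransPair ρ₁ ρ₂} (h : tp.toPlainPair.InConflict) :
    ∃ stp : SymbolicPair E ρ₁ ρ₂, stp.IsUseDeleteInitialConflict ∧ stp.Covers tp := by
  obtain ⟨tpI, hI⟩ := hR ρ₁ h₁ ρ₂ h₂ _ h
  obtain ⟨e, -⟩ := id hI
  have hc : tp.InConflict := fun hp => h hp.toPlainPair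
  exact ⟨SymbolicPair.ofPlainPair E tpI,
    ⟨⟨tp, ⟨e⟩, hc⟩, fun hp => h (e.parallelIndependent hp), tpI, hI.self,
      PlainPair.Isomorphic.refl _⟩,
    SymbolicPair.ofPlainPair_covers hM hE e hc⟩

/-- Conflicts whose underlying plain pair is parallel independent are covered by the AC initial
conflict at the coproduct injections. -/
lemma exists_acInitialConflict [HasBinaryCoproducts C] (hM : IsMAdhesive M)
    (hE : HasUniquePairFactorization E M) {tp : TransPair ρ₁ ρ₂} (h : tp.InConflict)
    (hp : tp.toPlainPair.ParallelIndependent) :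
    ∃ stp : SymbolicPair E ρ₁ ρ₂, stp.tp = coprodPair ρ₁.plain ρ₂.plain ∧
      stp.IsACInitialConflict ∧ stp.Covers tp := by
  obtain ⟨e⟩ := hp.nonempty_embedding
  exact ⟨SymbolicPair.ofPlainPair E _, rfl,
    ⟨⟨tp, ⟨e⟩, h⟩, coprodPair_isInitialParallelIndependent⟩,
    SymbolicPair.ofPlainPair_covers hM hE e h⟩

end Symbolic

end MAdhesive

theorem mainTheorem1 {C : Type u} [Category.{v} C] [HasBinaryCoproducts C]
    (M : MorphismProperty C) (hM : MAdhesive.IsMAdhesive M)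
    (E : MAdhesive.PairClass C) (hE : MAdhesive.HasUniquePairFactorization E M)
    (R : Set (MAdhesive.Rule M)) (hR : MAdhesive.HasInitialPairsForConflicts R)
    (ρ₁ ρ₂ : MAdhesive.Rule M) (h₁ : ρ₁ ∈ R) (h₂ : ρ₂ ∈ R) :
    MAdhesive.IsComplete {stp : MAdhesive.SymbolicPair E ρ₁ ρ₂ | stp.IsInitialConflict} ∧
    (∀ tp : MAdhesive.TransPair ρ₁ ρ₂, tp.UseDelete ∨ tp.DeleteUse →
      ∃ stp : MAdhesive.SymbolicPair E ρ₁ ρ₂, stp.IsUseDeleteInitialConflict ∧ stp.Covers tp) ∧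
    (∀ tp : MAdhesive.TransPair ρ₁ ρ₂, tp.ACConflict → ¬ (tp.UseDelete ∨ tp.DeleteUse) →
      ∃ stp : MAdhesive.SymbolicPair E ρ₁ ρ₂,
        stp.tp = MAdhesive.coprodPair ρ₁.plain ρ₂.plain ∧
          stp.IsACInitialConflict ∧ stp.Covers tp) := by
  refine ⟨fun tp h => ?_, fun tp h => ?_, fun tp h hn => ?_⟩
  -- The split concerns the plain pair alone: a use-delete or delete-use conflict that is also an AC
  -- conflict falls into the second case.
  · by_cases hp : tp.toPlainPair.ParallelIndependent
    · obtain ⟨stp, -, hs, hc⟩ := MAdhesive.exists_acInitialConflict hM hE h hp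
      exact ⟨stp, Or.inr hs, hc⟩
    · obtain ⟨stp, hs, hc⟩ := MAdhesive.exists_useDeleteInitialConflict hM hE hR h₁ h₂ hp
      exact ⟨stp, Or.inl hs, hc⟩
  · exact MAdhesive.exists_useDeleteInitialConflict hM hE hR h₁ h₂
      (MAdhesive.TransPair.inConflict_of_useDelete_or_deleteUse h)
  · exact MAdhesive.exists_acInitialConflict hM hE (h.inConflict hM)
      (MAdhesive.TransPair.parallelIndependent_of_not hn)
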